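/- Let $I_2(z)=\sum_{m\ge 0}\frac{(z/2)^{2m+2}}{m!\,(m+2)!}$ be the modified Bessel function of the first kind of order $2$. For $k\in\{1,2\}$ put \[ \alpha_k=\frac{5k+2}{2k+1},\qquad x_k(n)=\frac{\pi\sqrt{24n-(2k+2)}}{6},\qquad M_k(n)=\frac{\alpha_k\pi^3}{18\,x_k(n)^2}\,I_2\!\left(\sqrt{\alpha_k}\,x_k(n)\right), \] and \[ \Lambda_k(n)=\frac{M_k(n-1)\,M_k(n+1)}{M_k(n)^2}. \] Then for $k=1$ or $2$ and for every integer $n\ge 2$, \[ \begin{aligned} \Lambda_k(n)<{}&\left(1+\frac{5\pi^4}{9x_k(n)^4}+\frac{\pi^8}{3x_k(n)^8}\right) \left(1-\frac{\sqrt{\alpha_k}\,\pi^4}{9x_k(n)^3}+\frac{\alpha_k\pi^8}{81x_k(n)^6}\right)\\ &\times\left(1-\frac{5\pi^4}{8\sqrt{\alpha_k}\,x_k(n)^5}+\frac{292}{\alpha_k^3x_k(n)^6}\right) \end{aligned} \] and \[ \begin{aligned} \Lambda_k(n)>{}&\left(1+\frac{5\pi^4}{9x_k(n)^4}+\frac{5\pi^8}{18x_k(n)^8}\right)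 \left(1-\frac{\sqrt{\alpha_k}\,\pi^4}{9x_k(n)^3}-\frac{5\sqrt{\alpha_k}\,\pi^8}{162x_k(n)^7}\right)\\ &\times\left(1-\frac{5\pi^4}{8\sqrt{\alpha_k}\,x_k(n)^5}-\frac{5\pi^4}{6\alpha_kx_k(n)^6}-\frac{300}{\alpha_k^3x_k(n)^6}\right). \end{aligned} \] -/

import Mathlib

namespace BrokenDiamond

noncomputable section

/-- The modified Bessel function of the first kind `I_ν`, of integer order `ν ≥ 0`, at a real
argument: `I_ν(z) = ∑_{m ≥ 0} (z / 2)^(2 m + ν) / (m! (m + ν)!)`. -/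
def besselI (ν : ℕ) (z : ℝ) : ℝ :=
  ∑' m : ℕ, (z / 2) ^ (2 * m + ν) / ((m.factorial : ℝ) * ((m + ν).factorial : ℝ))

/-- The series that defines `I_ν(z)` converges for every real `z`. -/
theorem hasSum_besselI (ν : ℕ) (z : ℝ) :
    HasSum (fun m : ℕ =>
      (z / 2) ^ (2 * m + ν) / ((m.factorial : ℝ) * ((m + ν).factorial : ℝ))) (besselI ν z) := by
  refine Summable.hasSum ?_
  refine Summable.of_norm_bounded
    ((Real.summable_pow_div_factorial ((z / 2) ^ 2)).mul_left (|z / 2| ^ ν)) (fun m => ?_)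
  have h1 : (0 : ℝ) < (m.factorial : ℝ) := by exact_mod_cast m.factorial_pos
  have h2 : (1 : ℝ) ≤ ((m + ν).factorial : ℝ) := by exact_mod_cast (m + ν).factorial_pos
  have h3 : |z / 2| ^ (2 * m + ν) = |z / 2| ^ ν * ((z / 2) ^ 2) ^ m := by
    rw [pow_add, pow_mul, sq_abs, mul_comm]
  rw [Real.norm_eq_abs, abs_div, abs_pow, h3, mul_div_assoc,
    abs_of_pos (by positivity : (0 : ℝ) < (m.factorial : ℝ) * ((m + ν).factorial : ℝ))]
  gcongr
  nlinarith

/-- `x_k(n) = π √(24 n - (2 k + 2)) / 6`. -/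
def xk (k : ℕ) (n : ℝ) : ℝ :=
  Real.pi * Real.sqrt (24 * n - (2 * (k : ℝ) + 2)) / 6

/-- `α_k = (5 k + 2) / (2 k + 1)`. -/
def alphak (k : ℕ) : ℝ :=
  (5 * (k : ℝ) + 2) / (2 * (k : ℝ) + 1)

/-- `M_k(n) = α_k π³ / (18 x_k(n)²) · I_2(√α_k x_k(n))`. -/
def Mk (k : ℕ) (n : ℝ) : ℝ :=
  alphak k * Real.pi ^ 3 / (18 * xk k n ^ 2) * besselI 2 (Real.sqrt (alphak k) * xk k n)

/-- `Λ_k(n) = M_k(n - 1) M_k(n + 1) / M_k(n)²`. -/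
def Lambdak (k : ℕ) (n : ℝ) : ℝ :=
  Mk k (n - 1) * Mk k (n + 1) / Mk k n ^ 2

end

end BrokenDiamond

/-!
Write `G_ν(s) = ∑ s ^ m / (m! (m + ν)!)`, so that `I_2(z) = (z / 2)² G_2((z / 2)²)`. With
`w = √α_k x_k(n) / 2` and `ε = 24 / (24 n - 2 k - 2)`, the factors `x_k(m)²` in `M_k(m)` cancel and
`Λ_k(n) = G_2(w² (1 - ε)) G_2(w² (1 + ε)) / G_2(w²)²`, the exponential of a second difference of
`log G_2` (`Lambdak_eq_turanRatio`). So the task is to know `(log G_2)''` to sufficient accuracy.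

Since `G_ν' = G_{ν+1}` and `G_ν = (ν + 1) G_{ν+1} + s G_{ν+2}`, the quotient
`R(w) = w G_3(w²) / G_2(w²)` solves the Riccati equation `R' = 2 - 2 R² - 5 R / w`, and
`(log G_2)''(w²) = (1 - 3 R / w - R²) / w²`. Truncated asymptotic expansions of `R`, with the last
coefficient moved to either side of its true value, are a sub- and a supersolution of that equation,
and so enclose `R` (`ratioBarrier_le_besselRatio`, `besselRatio_le_ratioBarrier`). The resulting
bounds for `(log G_2)''` say that `log G_2` minus the explicit function `logModel C` is convex for
`C = 9` and concave for `C = -3` on the relevant half-line. Midpoint convexity then bounds `Λ_k(n)`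
by the exponential of the second difference of `logModel C`, which splits into the three factors of
the claim: `-(5/4) log s` gives the first, `2 √s` the second, and the terms of order `s^(-1/2)` and
`s⁻¹` the third. Each is estimated by elementary inequalities. This works for `w ≥ 43/10`, hence for
`n ≥ 5`.

For `n = 2, 3, 4` both sides are compared numerically: partial sums of the series of `G_2` with a
geometric bound for the tail, at arguments enclosed by means of decimal bounds for `π`
(`turan_bounds_of_enclosure`).
-/

namespace BrokenDiamond

/-! ### The entire functions `G_ν` -/

/-- The entire function `G_ν(s) = ∑ s ^ m / (m! (m + ν)!)`, which is `I_ν` with its zero at the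
origin divided out and its argument unfolded: `I_ν(z) = (z / 2) ^ ν * G_ν((z / 2) ^ 2)`. -/
noncomputable def besselG (ν : ℕ) (s : ℝ) : ℝ :=
  ∑' m : ℕ, s ^ m / ((m.factorial : ℝ) * ((m + ν).factorial : ℝ))

theorem summable_besselG (ν : ℕ) (s : ℝ) :
    Summable fun m : ℕ => s ^ m / ((m.factorial : ℝ) * ((m + ν).factorial : ℝ)) := by
  refine Summable.of_norm_bounded (Real.summable_pow_div_factorial |s|) fun m => ?_
  have h1 : (0 : ℝ) < (m.factorial : ℝ) := by exact_mod_cast m.factorial_pos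
  have h2 : (1 : ℝ) ≤ ((m + ν).factorial : ℝ) := by exact_mod_cast (m + ν).factorial_pos
  rw [Real.norm_eq_abs, abs_div, abs_pow,
    abs_of_pos (by positivity : (0 : ℝ) < (m.factorial : ℝ) * ((m + ν).factorial : ℝ))]
  gcongr
  nlinarith

theorem besselI_eq_besselG (ν : ℕ) (z : ℝ) :
    besselI ν z = (z / 2) ^ ν * besselG ν ((z / 2) ^ 2) := by
  rw [besselI, besselG, ← tsum_mul_left]
  refine tsum_congr fun m => ?_
  rw [pow_add, pow_mul]
  ring

theorem besselG_pos (ν : ℕ) {s : ℝ} (hs : 0 ≤ s) : 0 < besselG ν s := by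
  refine (summable_besselG ν s).tsum_pos (fun m => by positivity) 0 ?_
  have : (0 : ℝ) < ((0 + ν).factorial : ℝ) := by exact_mod_cast (0 + ν).factorial_pos
  simp only [pow_zero, Nat.factorial_zero, Nat.cast_one, one_mul]
  positivity

theorem besselG_mono (ν : ℕ) {s t : ℝ} (hs : 0 ≤ s) (h : s ≤ t) :
    besselG ν s ≤ besselG ν t :=
  (summable_besselG ν s).tsum_le_tsum (fun m => by gcongr) (summable_besselG ν t)

theorem hasDerivAt_besselG (ν : ℕ) (s : ℝ) :
    HasDerivAt (besselG ν) (besselG (ν + 1) s) s := by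
  have hterm (m : ℕ) : ((m + 1 : ℕ) : ℝ) / (((m + 1).factorial : ℝ) * ((m + 1 + ν).factorial : ℝ))
      = 1 / ((m.factorial : ℝ) * ((m + (ν + 1)).factorial : ℝ)) := by
    rw [show m + 1 + ν = m + (ν + 1) by ring, Nat.factorial_succ m]
    push_cast
    field_simp
  have hsum : Summable fun m : ℕ => (|s| + 1) ^ (m - 1) * m
      / ((m.factorial : ℝ) * ((m + ν).factorial : ℝ)) := by
    refine (summable_nat_add_iff 1).1 ((summable_besselG (ν + 1) (|s| + 1)).congr fun m => ?_)
    rw [mul_div_assoc, hterm, Nat.add_sub_cancel, mul_one_div]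
  have key := hasDerivAt_tsum_of_isPreconnected (t := Metric.ball (0 : ℝ) (|s| + 1)) (y₀ := s)
    (y := s) (g := fun (m : ℕ) (y : ℝ) => y ^ m / ((m.factorial : ℝ) * ((m + ν).factorial : ℝ)))
    (g' := fun (m : ℕ) (y : ℝ) => m * y ^ (m - 1)
      / ((m.factorial : ℝ) * ((m + ν).factorial : ℝ)))
    hsum Metric.isOpen_ball (convex_ball _ _).isPreconnected
    (fun m y _ => (hasDerivAt_pow m y).div_const _)
    (fun m y hy => ?_) (by simp) (summable_besselG ν s) (by simp)
  · have hs' : Summable fun m : ℕ => m * s ^ (m - 1)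
        / ((m.factorial : ℝ) * ((m + ν).factorial : ℝ)) := by
      refine (summable_nat_add_iff 1).1 ((summable_besselG (ν + 1) s).congr fun m => ?_)
      rw [mul_comm _ (s ^ _), mul_div_assoc, hterm, Nat.add_sub_cancel, mul_one_div]
    have e : besselG (ν + 1) s = ∑' m : ℕ, m * s ^ (m - 1)
        / ((m.factorial : ℝ) * ((m + ν).factorial : ℝ)) := by
      rw [hs'.tsum_eq_zero_add, besselG]
      simp only [CharP.cast_eq_zero, zero_mul, zero_div, zero_add]
      refine tsum_congr fun m => ?_
      rw [mul_comm (((m + 1 : ℕ) : ℝ)) (s ^ _), mul_div_assoc, hterm, Nat.add_sub_cancel,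
        mul_one_div]
    rw [e]
    exact key
  · have hy' : |y| ≤ |s| + 1 := by simpa using (Metric.mem_ball.1 hy).le
    rw [Real.norm_eq_abs, abs_div, abs_mul, abs_pow, Nat.abs_cast, mul_comm,
      abs_of_nonneg (by positivity : (0 : ℝ) ≤ (m.factorial : ℝ) * ((m + ν).factorial : ℝ))]
    gcongr

/-- The contiguity relation of the functions `G_ν`; with `G_ν' = G_{ν+1}` it is the Bessel
differential equation. -/
theorem besselG_contiguity (ν : ℕ) (s : ℝ) :
    besselG ν s = (ν + 1) * besselG (ν + 1) s + s * besselG (ν + 2) s := by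
  simp only [besselG]
  rw [(summable_besselG ν s).tsum_eq_zero_add, (summable_besselG (ν + 1) s).tsum_eq_zero_add,
    mul_add, add_assoc, ← tsum_mul_left, ← tsum_mul_left, ← Summable.tsum_add]
  · congr 1
    · simp only [pow_zero, zero_add, Nat.factorial_zero, Nat.factorial_succ ν]
      push_cast
      field_simp
    · refine tsum_congr fun m => ?_
      rw [show m + 1 + (ν + 1) = (m + 1 + ν) + 1 by ring,
        show m + (ν + 2) = (m + 1 + ν) + 1 by ring,
        Nat.factorial_succ (m + 1 + ν), Nat.factorial_succ m]
      push_cast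
      field_simp
      ring
  · exact ((summable_nat_add_iff 1).2 (summable_besselG (ν + 1) s)).mul_left _
  · exact (summable_besselG (ν + 2) s).mul_left _

theorem besselG_succ_le (ν : ℕ) {s : ℝ} (hs : 0 ≤ s) :
    (ν + 1) * besselG (ν + 1) s ≤ besselG ν s := by
  rw [besselG_contiguity ν s]
  have := mul_nonneg hs (besselG_pos (ν + 2) hs).le
  linarith

theorem sum_le_besselG (ν M : ℕ) {s : ℝ} (hs : 0 ≤ s) :
    ∑ m ∈ Finset.range M, s ^ m / ((m.factorial : ℝ) * ((m + ν).factorial : ℝ)) ≤ besselG ν s :=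
  (summable_besselG ν s).sum_le_tsum _ fun m _ => by positivity

/-- Once consecutive terms at least halve, the tail of the series is at most twice its first
term. -/
theorem besselG_le_sum_add (ν M : ℕ) {s : ℝ} (hs : 0 ≤ s)
    (h : 2 * s ≤ (M + 1) * (M + ν + 1)) :
    besselG ν s ≤ ∑ m ∈ Finset.range M, s ^ m / ((m.factorial : ℝ) * ((m + ν).factorial : ℝ))
      + 2 * (s ^ M / ((M.factorial : ℝ) * ((M + ν).factorial : ℝ))) := by
  rw [besselG, ← (summable_besselG ν s).sum_add_tsum_nat_add M]
  gcongr
  set c := s ^ M / ((M.factorial : ℝ) * ((M + ν).factorial : ℝ)) with hc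
  have hc0 : 0 ≤ c := by positivity
  have hbound (j : ℕ) : s ^ (j + M) / (((j + M).factorial : ℝ) * ((j + M + ν).factorial : ℝ))
      ≤ c * (1 / 2) ^ j := by
    induction j with
    | zero => simp [hc]
    | succ j ih =>
      have e : s ^ (j + 1 + M) / (((j + 1 + M).factorial : ℝ) * ((j + 1 + M + ν).factorial : ℝ))
          = s ^ (j + M) / (((j + M).factorial : ℝ) * ((j + M + ν).factorial : ℝ))
            * (s / ((j + M + 1) * (j + M + ν + 1))) := by
        rw [show j + 1 + M = (j + M) + 1 by ring, show j + M + 1 + ν = (j + M + ν) + 1 by ring,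
          Nat.factorial_succ (j + M), Nat.factorial_succ (j + M + ν)]
        push_cast
        field_simp
        ring
      rw [e, pow_succ, ← mul_assoc]
      refine mul_le_mul ih ?_ (by positivity) (by positivity)
      rw [div_le_iff₀ (by positivity)]
      have hj : (0 : ℝ) ≤ j := j.cast_nonneg
      have : ((M : ℝ) + 1) * (M + ν + 1) ≤ (j + M + 1) * (j + M + ν + 1) := by
        gcongr <;> linarith
      linarith
  calc _ ≤ ∑' j : ℕ, c * (1 / 2 : ℝ) ^ j :=
        ((summable_nat_add_iff M).2 (summable_besselG ν s)).tsum_le_tsum hbound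
          (summable_geometric_two.mul_left c)
    _ = 2 * c := by rw [tsum_mul_left, tsum_geometric_two, mul_comm]

/-! ### The Riccati equation of the Bessel quotient -/

/-- The quotient `I_3(2 w) / I_2(2 w)`, written through the entire functions `G_3` and `G_2`. -/
noncomputable def besselRatio (w : ℝ) : ℝ :=
  w * besselG 3 (w ^ 2) / besselG 2 (w ^ 2)

/-- The Riccati equation of the Bessel quotient. -/
theorem hasDerivAt_besselRatio {w : ℝ} (hw : 0 < w) :
    HasDerivAt besselRatio (2 - 2 * besselRatio w ^ 2 - 5 * besselRatio w / w) w := by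
  have h2 := besselG_pos 2 (sq_nonneg w)
  have hc : besselG 2 (w ^ 2) = 3 * besselG 3 (w ^ 2) + w ^ 2 * besselG 4 (w ^ 2) := by
    have := besselG_contiguity 2 (w ^ 2)
    norm_num at this
    exact this
  have hsq := hasDerivAt_pow 2 w
  have d3 := (hasDerivAt_besselG 3 (w ^ 2)).comp w hsq
  have d2 := (hasDerivAt_besselG 2 (w ^ 2)).comp w hsq
  have h := ((hasDerivAt_id w).mul d3).div d2 h2.ne'
  refine HasDerivAt.congr_deriv (f' := _) h ?_
  have hc' : w ^ 2 * besselG 4 (w ^ 2) = besselG 2 (w ^ 2) - 3 * besselG 3 (w ^ 2) := by linarith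
  simp only [besselRatio, Function.comp, Pi.mul_apply, id]
  norm_num
  field_simp
  linear_combination (2 * besselG 2 (w ^ 2)) * hc'

theorem besselRatio_nonneg {w : ℝ} (hw : 0 ≤ w) : 0 ≤ besselRatio w :=
  div_nonneg (mul_nonneg hw (besselG_pos 3 (sq_nonneg w)).le) (besselG_pos 2 (sq_nonneg w)).le

theorem besselRatio_le {w : ℝ} (hw : 0 ≤ w) : besselRatio w ≤ w / 3 := by
  have h := besselG_succ_le 2 (sq_nonneg w)
  norm_num at h
  rw [besselRatio, div_le_iff₀ (besselG_pos 2 (sq_nonneg w))]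
  nlinarith

/-- The asymptotic expansion of the Bessel quotient up to order `w⁻³`, with a free coefficient
of `w⁻⁴`; the true coefficient is `135 / 2048`. -/
noncomputable def ratioBarrier (c w : ℝ) : ℝ :=
  (64 * w ^ 4 - 80 * w ^ 3 + 30 * w ^ 2 + 15 * w + 64 * c) / (64 * w ^ 4)

theorem hasDerivAt_ratioBarrier (c : ℝ) {w : ℝ} (hw : w ≠ 0) :
    HasDerivAt (ratioBarrier c)
      ((80 * w ^ 3 - 60 * w ^ 2 - 45 * w - 256 * c) / (64 * w ^ 5)) w := by
  have hn : HasDerivAt (fun w : ℝ => 64 * w ^ 4 - 80 * w ^ 3 + 30 * w ^ 2 + 15 * w + 64 * c)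
      (256 * w ^ 3 - 240 * w ^ 2 + 60 * w + 15) w := by
    refine ((((((hasDerivAt_pow 4 w).const_mul 64).sub ((hasDerivAt_pow 3 w).const_mul 80)).add
      ((hasDerivAt_pow 2 w).const_mul 30)).add ((hasDerivAt_id w).const_mul 15)).add_const
        (64 * c)).congr_deriv ?_
    norm_num
    ring
  refine (hn.div ((hasDerivAt_pow 4 w).const_mul 64) (by positivity)).congr_deriv ?_
  norm_num
  field_simp
  ring

/-- The barrier with last coefficient `-1/4` is a strict subsolution of the Riccati equation, and
it is negative at `w = 3/4`. -/
theorem ratioBarrier_le_besselRatio {w : ℝ} (hw : 3 / 4 ≤ w) :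
    ratioBarrier (-1 / 4) w ≤ besselRatio w := by
  have hpos {x : ℝ} (hx : 3 / 4 ≤ x) : 0 < x := by linarith
  refine image_le_of_deriv_right_lt_deriv_boundary' (a := 3 / 4) (b := w)
    (fun x hx => (hasDerivAt_ratioBarrier _ (hpos hx.1).ne').continuousAt.continuousWithinAt)
    (fun x hx => (hasDerivAt_ratioBarrier _ (hpos hx.1).ne').hasDerivWithinAt) ?_
    (fun x hx => (hasDerivAt_besselRatio (hpos hx.1)).continuousAt.continuousWithinAt)
    (fun x hx => (hasDerivAt_besselRatio (hpos hx.1)).hasDerivWithinAt) ?_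
    (Set.right_mem_Icc.2 hw)
  · refine le_trans ?_ (besselRatio_nonneg (by norm_num))
    norm_num [ratioBarrier]
  · intro x hx he
    have h0 := hpos hx.1
    rw [← he, ← sub_pos]
    have e : 2 - 2 * ratioBarrier (-1 / 4) x ^ 2 - 5 * ratioBarrier (-1 / 4) x / x
        - (80 * x ^ 3 - 60 * x ^ 2 - 45 * x - 256 * (-1 / 4)) / (64 * x ^ 5)
        = (2588 * x ^ 4 - 2948 * x ^ 3 + 735 * x ^ 2 + 480 * x - 256) / (2048 * x ^ 8) := by
      rw [ratioBarrier]
      field_simp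
      ring
    rw [e]
    -- Expanded about `3 / 4`, the numerator has nonnegative coefficients.
    obtain ⟨h, rfl⟩ : ∃ h, x = 3 / 4 + h := ⟨x - 3 / 4, by ring⟩
    have hh : 0 ≤ h := by linarith [hx.1]
    refine div_pos ?_ (by positivity)
    ring_nf
    positivity

/-- The barrier with last coefficient `9/128` is a strict supersolution of the Riccati equation,
and it exceeds `w / 3` at `w = 1/2`. -/
theorem besselRatio_le_ratioBarrier {w : ℝ} (hw : 1 / 2 ≤ w) :
    besselRatio w ≤ ratioBarrier (9 / 128) w := by
  have hpos {x : ℝ} (hx : 1 / 2 ≤ x) : 0 < x := by linarith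
  refine image_le_of_deriv_right_lt_deriv_boundary' (a := 1 / 2) (b := w)
    (fun x hx => (hasDerivAt_besselRatio (hpos hx.1)).continuousAt.continuousWithinAt)
    (fun x hx => (hasDerivAt_besselRatio (hpos hx.1)).hasDerivWithinAt) ?_
    (fun x hx => (hasDerivAt_ratioBarrier _ (hpos hx.1).ne').continuousAt.continuousWithinAt)
    (fun x hx => (hasDerivAt_ratioBarrier _ (hpos hx.1).ne').hasDerivWithinAt) ?_
    (Set.right_mem_Icc.2 hw)
  · refine (besselRatio_le (by norm_num)).trans ?_
    norm_num [ratioBarrier]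
  · intro x hx he
    have h0 := hpos hx.1
    rw [he, ← sub_pos]
    have e : (80 * x ^ 3 - 60 * x ^ 2 - 45 * x - 256 * (9 / 128)) / (64 * x ^ 5)
        - (2 - 2 * ratioBarrier (9 / 128) x ^ 2 - 5 * ratioBarrier (9 / 128) x / x)
        = (36 * x ^ 4 + 324 * x ^ 3 + 495 * x ^ 2 + 135 * x + 81 / 4) / (2048 * x ^ 8) := by
      rw [ratioBarrier]
      field_simp
      ring
    rw [e]
    positivity

/-! ### The second derivative of `log G_2` -/

/-- The second derivative of `log G_2`, expressed through the Bessel quotient. -/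
theorem besselG_logDeriv2_eq {w : ℝ} (hw : 0 < w) :
    (besselG 4 (w ^ 2) * besselG 2 (w ^ 2) - besselG 3 (w ^ 2) * besselG 3 (w ^ 2))
        / besselG 2 (w ^ 2) ^ 2
      = (1 - 3 * besselRatio w / w - besselRatio w ^ 2) / w ^ 2 := by
  have h2 := besselG_pos 2 (sq_nonneg w)
  have hc : besselG 2 (w ^ 2) = 3 * besselG 3 (w ^ 2) + w ^ 2 * besselG 4 (w ^ 2) := by
    have := besselG_contiguity 2 (w ^ 2)
    norm_num at this
    exact this
  rw [besselRatio]
  field_simp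
  linear_combination (-besselG 2 (w ^ 2)) * hc

/-- The model `2 √s - (5/4) log s - (15/16) / √s - (C/32) / s` of `log G_2(s)`, up to a constant;
the asymptotic expansion of `log G_2` has `C = 15 / 2`. -/
noncomputable def logModel (C s : ℝ) : ℝ :=
  2 * √s - 5 / 4 * Real.log s - 15 / 16 * (√s)⁻¹ - C / 32 * s⁻¹

theorem hasDerivAt_logModel (C : ℝ) {s : ℝ} (hs : 0 < s) :
    HasDerivAt (logModel C)
      ((√s)⁻¹ - 5 / 4 * s⁻¹ + 15 / 32 * ((√s)⁻¹ * s⁻¹) + C / 32 * (s⁻¹ * s⁻¹)) s := by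
  have hw : 0 < √s := Real.sqrt_pos.2 hs
  have d1 := Real.hasDerivAt_sqrt hs.ne'
  refine ((((d1.const_mul 2).sub ((Real.hasDerivAt_log hs.ne').const_mul (5 / 4))).sub
    ((d1.inv hw.ne').const_mul (15 / 16))).sub
      ((hasDerivAt_inv hs.ne').const_mul (C / 32))).congr_deriv ?_
  rw [Real.sq_sqrt hs.le]
  field_simp
  ring

theorem hasDerivAt_deriv_logModel (C : ℝ) {s : ℝ} (hs : 0 < s) :
    HasDerivAt (fun s =>
        (√s)⁻¹ - 5 / 4 * s⁻¹ + 15 / 32 * ((√s)⁻¹ * s⁻¹) + C / 32 * (s⁻¹ * s⁻¹))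
      ((-(1 / (2 * √s)) + 5 / (4 * √s ^ 2) - 45 / (64 * √s ^ 3) - C / (16 * √s ^ 4)) / √s ^ 2)
      s := by
  have hw : 0 < √s := Real.sqrt_pos.2 hs
  have d1 := (Real.hasDerivAt_sqrt hs.ne').inv hw.ne'
  have d2 := hasDerivAt_inv hs.ne'
  refine (((d1.sub (d2.const_mul (5 / 4))).add ((d1.mul d2).const_mul (15 / 32))).add
    ((d2.mul d2).const_mul (C / 32))).congr_deriv ?_
  obtain ⟨w, hw', rfl⟩ : ∃ w : ℝ, 0 < w ∧ s = w ^ 2 := ⟨√s, hw, (Real.sq_sqrt hs.le).symm⟩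
  simp only [Real.sqrt_sq hw'.le, Pi.inv_apply]
  field_simp
  ring

/-- The factor `w² (log G_2)''(w²)` lies below the corresponding factor of `logModel (-3)`. -/
theorem besselRatio_curvature_le {w : ℝ} (hw : 19 / 5 ≤ w) :
    1 - 3 * besselRatio w / w - besselRatio w ^ 2
      ≤ -(1 / (2 * w)) + 5 / (4 * w ^ 2) - 45 / (64 * w ^ 3) - -3 / (16 * w ^ 4) := by
  have h0 : 0 < w := by linarith
  have hp := ratioBarrier_le_besselRatio (w := w) (by linarith)
  have hp0 : 0 ≤ ratioBarrier (-1 / 4) w := by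
    -- The coefficients of the expansion about `19 / 5` are nonnegative; likewise below.
    obtain ⟨h, rfl⟩ : ∃ h, w = 19 / 5 + h := ⟨w - 19 / 5, by ring⟩
    have hh : 0 ≤ h := by linarith
    refine div_nonneg ?_ (by positivity)
    ring_nf
    positivity
  calc 1 - 3 * besselRatio w / w - besselRatio w ^ 2
      ≤ 1 - 3 * ratioBarrier (-1 / 4) w / w - ratioBarrier (-1 / 4) w ^ 2 := by gcongr
    _ ≤ _ := by
      rw [← sub_nonneg]
      have e : -(1 / (2 * w)) + 5 / (4 * w ^ 2) - 45 / (64 * w ^ 3) - -3 / (16 * w ^ 4)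
          - (1 - 3 * ratioBarrier (-1 / 4) w / w - ratioBarrier (-1 / 4) w ^ 2)
          = (25 / 4 * w ^ 4 + 97 / 4 * w ^ 3 - 735 / 16 * w ^ 2 - 30 * w + 16) / (256 * w ^ 8) := by
        rw [ratioBarrier]
        field_simp
        ring
      rw [e]
      obtain ⟨h, rfl⟩ : ∃ h, w = 19 / 5 + h := ⟨w - 19 / 5, by ring⟩
      have hh : 0 ≤ h := by linarith
      refine div_nonneg ?_ (by positivity)
      ring_nf
      positivity

/-- The factor `w² (log G_2)''(w²)` lies above the corresponding factor of `logModel 9`. -/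
theorem le_besselRatio_curvature {w : ℝ} (hw : 19 / 5 ≤ w) :
    -(1 / (2 * w)) + 5 / (4 * w ^ 2) - 45 / (64 * w ^ 3) - 9 / (16 * w ^ 4)
      ≤ 1 - 3 * besselRatio w / w - besselRatio w ^ 2 := by
  have h0 : 0 < w := by linarith
  have hq := besselRatio_le_ratioBarrier (w := w) (by linarith)
  have hr := besselRatio_nonneg h0.le
  calc _ ≤ 1 - 3 * ratioBarrier (9 / 128) w / w - ratioBarrier (9 / 128) w ^ 2 := by
        rw [← sub_nonneg]
        have e : 1 - 3 * ratioBarrier (9 / 128) w / w - ratioBarrier (9 / 128) w ^ 2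
            - (-(1 / (2 * w)) + 5 / (4 * w ^ 2) - 45 / (64 * w ^ 3) - 9 / (16 * w ^ 4))
            = (87 / 4 * w ^ 4 - 261 / 4 * w ^ 3 - 495 / 16 * w ^ 2 - 135 / 16 * w - 81 / 64)
              / (256 * w ^ 8) := by
          rw [ratioBarrier]
          field_simp
          ring
        rw [e]
        -- The coefficients of the expansion about `19 / 5` are nonnegative.
        obtain ⟨h, rfl⟩ : ∃ h, w = 19 / 5 + h := ⟨w - 19 / 5, by ring⟩
        have hh : 0 ≤ h := by linarith
        refine div_nonneg ?_ (by positivity)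
        ring_nf
        positivity
    _ ≤ _ := by gcongr

theorem hasDerivAt_log_besselG_sub {s : ℝ} (C : ℝ) (hs : 0 < s) :
    HasDerivAt (fun s => Real.log (besselG 2 s) - logModel C s)
      (besselG 3 s / besselG 2 s -
        ((√s)⁻¹ - 5 / 4 * s⁻¹ + 15 / 32 * ((√s)⁻¹ * s⁻¹) + C / 32 * (s⁻¹ * s⁻¹))) s :=
  ((hasDerivAt_besselG 2 s).log (besselG_pos 2 hs.le).ne').sub (hasDerivAt_logModel C hs)

theorem hasDerivAt_deriv_log_besselG_sub {s : ℝ} (C : ℝ) (hs : 0 < s) :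
    HasDerivAt (fun s => besselG 3 s / besselG 2 s -
        ((√s)⁻¹ - 5 / 4 * s⁻¹ + 15 / 32 * ((√s)⁻¹ * s⁻¹) + C / 32 * (s⁻¹ * s⁻¹)))
      ((1 - 3 * besselRatio √s / √s - besselRatio √s ^ 2 -
        (-(1 / (2 * √s)) + 5 / (4 * √s ^ 2) - 45 / (64 * √s ^ 3) - C / (16 * √s ^ 4))) / √s ^ 2)
      s := by
  refine (((hasDerivAt_besselG 3 s).div (hasDerivAt_besselG 2 s) (besselG_pos 2 hs.le).ne').sub
    (hasDerivAt_deriv_logModel C hs)).congr_deriv ?_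
  have h := besselG_logDeriv2_eq (Real.sqrt_pos.2 hs)
  rw [Real.sq_sqrt hs.le] at h
  norm_num
  rw [h, Real.sq_sqrt hs.le]
  ring

theorem le_sqrt_of_mem_interior {s : ℝ} (hs : s ∈ interior (Set.Ici ((19 / 5 : ℝ) ^ 2))) :
    0 < s ∧ 19 / 5 ≤ √s := by
  rw [interior_Ici, Set.mem_Ioi] at hs
  exact ⟨by linarith, Real.le_sqrt_of_sq_le hs.le⟩

theorem convexOn_log_besselG_sub :
    ConvexOn ℝ (Set.Ici ((19 / 5 : ℝ) ^ 2))
      (fun s => Real.log (besselG 2 s) - logModel 9 s) := by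
  refine convexOn_of_hasDerivWithinAt2_nonneg (convex_Ici _)
    (fun s hs => (hasDerivAt_log_besselG_sub 9
      (lt_of_lt_of_le (by norm_num) hs)).continuousAt.continuousWithinAt)
    (fun s hs => (hasDerivAt_log_besselG_sub 9
      (le_sqrt_of_mem_interior hs).1).hasDerivWithinAt)
    (fun s hs => (hasDerivAt_deriv_log_besselG_sub 9
      (le_sqrt_of_mem_interior hs).1).hasDerivWithinAt)
    (fun s hs => div_nonneg (sub_nonneg.2
      (le_besselRatio_curvature (le_sqrt_of_mem_interior hs).2)) (sq_nonneg _))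

theorem concaveOn_log_besselG_sub :
    ConcaveOn ℝ (Set.Ici ((19 / 5 : ℝ) ^ 2))
      (fun s => Real.log (besselG 2 s) - logModel (-3) s) := by
  refine concaveOn_of_hasDerivWithinAt2_nonpos (convex_Ici _)
    (fun s hs => (hasDerivAt_log_besselG_sub (-3)
      (lt_of_lt_of_le (by norm_num) hs)).continuousAt.continuousWithinAt)
    (fun s hs => (hasDerivAt_log_besselG_sub (-3)
      (le_sqrt_of_mem_interior hs).1).hasDerivWithinAt)
    (fun s hs => (hasDerivAt_deriv_log_besselG_sub (-3)
      (le_sqrt_of_mem_interior hs).1).hasDerivWithinAt)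
    (fun s hs => div_nonpos_of_nonpos_of_nonneg (sub_nonpos.2
      (besselRatio_curvature_le (le_sqrt_of_mem_interior hs).2)) (sq_nonneg _))

/-! ### Second differences -/

/-- The quotient `G_2(w² (1 - ε)) G_2(w² (1 + ε)) / G_2(w²)²`; with `w = √α_k x_k(n) / 2` and
`ε = 24 / (24 n - 2 k - 2)` it is `Λ_k(n)`. -/
noncomputable def turanRatio (w ε : ℝ) : ℝ :=
  besselG 2 (w ^ 2 * (1 - ε)) * besselG 2 (w ^ 2 * (1 + ε)) / besselG 2 (w ^ 2) ^ 2

/-- The upper bound for `turanRatio`; `73/16 = 292/64`, as `√α_k x_k(n) = 2 w`. -/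
noncomputable def turanUpper (w ε : ℝ) : ℝ :=
  (1 + 5 / 4 * ε ^ 2 + 27 / 16 * ε ^ 4) * (1 - w * ε ^ 2 / 2 + (w * ε ^ 2 / 2) ^ 2)
    * (1 - 45 * ε ^ 2 / (64 * w) + 73 / (16 * w ^ 6))

/-- The lower bound for `turanRatio`; `75/16 = 300/64`, as `√α_k x_k(n) = 2 w`. -/
noncomputable def turanLower (w ε : ℝ) : ℝ :=
  (1 + 5 / 4 * ε ^ 2 + 45 / 32 * ε ^ 4) * (1 - w * ε ^ 2 / 2 - 5 * w * ε ^ 4 / 16)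
    * (1 - 45 * ε ^ 2 / (64 * w) - 15 * ε ^ 2 / (32 * w ^ 2) - 75 / (16 * w ^ 6))

theorem logModel_second_difference (C : ℝ) {w ε : ℝ} (hw : 0 < w) (h0 : 0 ≤ ε) (h1 : ε < 1) :
    logModel C (w ^ 2 * (1 - ε)) + logModel C (w ^ 2 * (1 + ε)) - 2 * logModel C (w ^ 2)
      = -(5 / 4) * Real.log (1 - ε ^ 2) + 2 * w * (√(1 - ε) + √(1 + ε) - 2)
        + (-(15 / (16 * w)) * ((√(1 - ε))⁻¹ + (√(1 + ε))⁻¹ - 2)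
          - C / 16 * (ε ^ 2 / (w ^ 2 * (1 - ε ^ 2)))) := by
  have hm : 0 < 1 - ε := by linarith
  have hp : 0 < 1 + ε := by linarith
  have hlog : Real.log (1 - ε ^ 2) = Real.log (1 - ε) + Real.log (1 + ε) := by
    rw [← Real.log_mul hm.ne' hp.ne']
    ring_nf
  have hinv : (w ^ 2 * (1 - ε))⁻¹ + (w ^ 2 * (1 + ε))⁻¹ - 2 * (w ^ 2)⁻¹
      = 2 * (ε ^ 2 / (w ^ 2 * (1 - ε ^ 2))) := by
    rw [show 1 - ε ^ 2 = (1 - ε) * (1 + ε) by ring]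
    field_simp
    ring
  simp only [logModel, Real.sqrt_mul (sq_nonneg w), Real.sqrt_sq hw.le, hlog,
    Real.log_mul (pow_ne_zero 2 hw.ne') hm.ne', Real.log_mul (pow_ne_zero 2 hw.ne') hp.ne',
    mul_inv w]
  have hw' : 15 / (16 * w) = 15 / 16 * w⁻¹ := by rw [div_mul_eq_div_div, div_eq_mul_inv _ w]
  rw [hw']
  linear_combination (-(C / 32)) * hinv

theorem turanRatio_eq_exp {w ε : ℝ} (h0 : 0 ≤ ε) (h1 : ε < 1) :
    turanRatio w ε = Real.exp (Real.log (besselG 2 (w ^ 2 * (1 - ε)))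
      + Real.log (besselG 2 (w ^ 2 * (1 + ε))) - 2 * Real.log (besselG 2 (w ^ 2))) := by
  have hm := besselG_pos 2 (mul_nonneg (sq_nonneg w) (sub_nonneg.2 h1.le))
  have hp := besselG_pos 2 (mul_nonneg (sq_nonneg w) (by linarith : 0 ≤ 1 + ε))
  have h := besselG_pos 2 (sq_nonneg w)
  rw [two_mul, Real.exp_sub, Real.exp_add, Real.exp_add, Real.exp_log hm, Real.exp_log hp,
    Real.exp_log h, turanRatio, sq (besselG 2 _)]

/-- Concavity of `log G_2 - logModel (-3)` compares second differences. -/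
theorem turanRatio_le_exp_logModel {w ε : ℝ} (h0 : 0 ≤ ε) (h1 : ε < 1)
    (h : (19 / 5) ^ 2 ≤ w ^ 2 * (1 - ε)) :
    turanRatio w ε ≤ Real.exp (logModel (-3) (w ^ 2 * (1 - ε))
      + logModel (-3) (w ^ 2 * (1 + ε)) - 2 * logModel (-3) (w ^ 2)) := by
  have h2 : w ^ 2 * (1 - ε) ≤ w ^ 2 * (1 + ε) :=
    mul_le_mul_of_nonneg_left (by linarith) (sq_nonneg w)
  have key := concaveOn_log_besselG_sub.2 (Set.mem_Ici.2 h) (Set.mem_Ici.2 (h.trans h2))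
    (by norm_num : (0 : ℝ) ≤ 1 / 2) (by norm_num : (0 : ℝ) ≤ 1 / 2) (by norm_num)
  simp only [smul_eq_mul] at key
  rw [show 1 / 2 * (w ^ 2 * (1 - ε)) + 1 / 2 * (w ^ 2 * (1 + ε)) = w ^ 2 by ring] at key
  rw [turanRatio_eq_exp h0 h1, Real.exp_le_exp]
  linarith

/-- Convexity of `log G_2 - logModel 9` compares second differences. -/
theorem exp_logModel_le_turanRatio {w ε : ℝ} (h0 : 0 ≤ ε) (h1 : ε < 1)
    (h : (19 / 5) ^ 2 ≤ w ^ 2 * (1 - ε)) :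
    Real.exp (logModel 9 (w ^ 2 * (1 - ε))
      + logModel 9 (w ^ 2 * (1 + ε)) - 2 * logModel 9 (w ^ 2)) ≤ turanRatio w ε := by
  have h2 : w ^ 2 * (1 - ε) ≤ w ^ 2 * (1 + ε) :=
    mul_le_mul_of_nonneg_left (by linarith) (sq_nonneg w)
  have key := convexOn_log_besselG_sub.2 (Set.mem_Ici.2 h) (Set.mem_Ici.2 (h.trans h2))
    (by norm_num : (0 : ℝ) ≤ 1 / 2) (by norm_num : (0 : ℝ) ≤ 1 / 2) (by norm_num)
  simp only [smul_eq_mul] at key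
  rw [show 1 / 2 * (w ^ 2 * (1 - ε)) + 1 / 2 * (w ^ 2 * (1 + ε)) = w ^ 2 by ring] at key
  rw [turanRatio_eq_exp h0 h1, Real.exp_le_exp]
  linarith

/-! ### Elementary inequalities for powers of `1 ± ε` -/

/-- The Taylor coefficient of `t²` in `(1 - t) ^ (-5/4)` is `45/32 < 27/16`; raised to the fourth
power and multiplied by `(1 - t)⁵`, the claim is a polynomial inequality. -/
theorem exp_neg_five_fourths_log_le {t : ℝ} (h0 : 0 ≤ t) (h1 : t ≤ 1 / 20) :
    Real.exp (-(5 / 4) * Real.log (1 - t)) ≤ 1 + 5 / 4 * t + 27 / 16 * t ^ 2 := by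
  have hP : 0 < 1 + 5 / 4 * t + 27 / 16 * t ^ 2 := by positivity
  have ht : 0 < 1 - t := by linarith
  rw [← Real.le_log_iff_exp_le hP]
  have h : 1 ≤ (1 - t) ^ 5 * (1 + 5 / 4 * t + 27 / 16 * t ^ 2) ^ 4 := by
    have h3 : t ^ 3 ≤ t / 400 := by nlinarith [pow_le_pow_left₀ h0 h1 2]
    have hpow (j : ℕ) (hj : 3 ≤ j := by norm_num) : t ^ j ≤ t / 400 :=
      (pow_le_pow_of_le_one h0 (by linarith) hj).trans h3
    have hq : 0 ≤ t ^ 2 * (9 / 8 - 15 / 2 * t + 459 / 256 * t ^ 2 - 1521 / 256 * t ^ 3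
        + 46041 / 2048 * t ^ 4 - 35883 / 4096 * t ^ 5 + 713601 / 65536 * t ^ 6
        - 2040469 / 65536 * t ^ 7 + 475605 / 32768 * t ^ 8 - 225261 / 32768 * t ^ 9
        + 1082565 / 65536 * t ^ 10 - 531441 / 65536 * t ^ 11) := by
      refine mul_nonneg (sq_nonneg t) ?_
      linarith [hpow 3, hpow 5, hpow 7, hpow 9, hpow 11, pow_nonneg h0 2, pow_nonneg h0 4,
        pow_nonneg h0 6, pow_nonneg h0 8, pow_nonneg h0 10]
    linarith
  have := Real.log_nonneg h
  rw [Real.log_mul (by positivity) (by positivity), Real.log_pow, Real.log_pow] at this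
  push_cast at this
  linarith

theorem le_exp_neg_five_fourths_log {t : ℝ} (h0 : 0 ≤ t) (h1 : t ≤ 1 / 20) :
    1 + 5 / 4 * t + 45 / 32 * t ^ 2 ≤ Real.exp (-(5 / 4) * Real.log (1 - t)) := by
  have hP : 0 < 1 + 5 / 4 * t + 45 / 32 * t ^ 2 := by positivity
  have ht : 0 < 1 - t := by linarith
  rw [← Real.log_le_iff_le_exp hP]
  have h : (1 - t) ^ 5 * (1 + 5 / 4 * t + 45 / 32 * t ^ 2) ^ 4 ≤ 1 := by
    have hpow (j : ℕ) (hj : 1 ≤ j := by norm_num) : t ^ j ≤ t :=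
      pow_le_of_le_one h0 (by linarith) (by omega)
    have hq : 0 ≤ t ^ 3 * (195 / 32 - 585 / 512 * t - 351 / 1024 * t ^ 2 - 7215 / 512 * t ^ 3
        + 167895 / 32768 * t ^ 4 + 1061775 / 1048576 * t ^ 5 + 15272725 / 1048576 * t ^ 6
        - 4051125 / 524288 * t ^ 7 - 394875 / 524288 * t ^ 8 - 5923125 / 1048576 * t ^ 9
        + 4100625 / 1048576 * t ^ 10) := by
      refine mul_nonneg (pow_nonneg h0 3) ?_
      linarith [hpow 2, hpow 3, hpow 7, hpow 8, hpow 9, pow_nonneg h0 4, pow_nonneg h0 5,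
        pow_nonneg h0 6, pow_nonneg h0 10]
    linarith
  have := Real.log_nonpos (by positivity) h
  rw [Real.log_mul (by positivity) (by positivity), Real.log_pow, Real.log_pow] at this
  push_cast at this
  linarith

/-- Each root is compared with its Taylor polynomial of degree three; the odd terms cancel. -/
theorem sqrt_add_sqrt_le {ε : ℝ} (h0 : 0 ≤ ε) (h1 : ε ≤ 1 / 4) :
    √(1 - ε) + √(1 + ε) - 2 ≤ -(ε ^ 2 / 4) := by
  have hm : √(1 - ε) ≤ 1 - ε / 2 - ε ^ 2 / 8 - ε ^ 3 / 16 := by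
    refine Real.sqrt_le_iff.2 ⟨by nlinarith [pow_nonneg h0 2], ?_⟩
    have : 0 ≤ ε ^ 4 * (5 / 64 + ε / 64 + ε ^ 2 / 256) := by positivity
    linarith
  have hp : √(1 + ε) ≤ 1 + ε / 2 - ε ^ 2 / 8 + ε ^ 3 / 16 := by
    refine Real.sqrt_le_iff.2 ⟨by nlinarith [pow_nonneg h0 3], ?_⟩
    have : 0 ≤ ε ^ 4 * ((5 - ε) / 64 + ε ^ 2 / 256) :=
      mul_nonneg (by positivity) (add_nonneg (by linarith) (by positivity))
    linarith
  linarith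

/-- Twice the Taylor coefficient of `ε⁴` leaves room for the remainder. -/
theorem le_sqrt_add_sqrt {ε : ℝ} (h0 : 0 ≤ ε) (h1 : ε ≤ 1 / 4) :
    -(ε ^ 2 / 4) - 5 * ε ^ 4 / 32 ≤ √(1 - ε) + √(1 + ε) - 2 := by
  have hpow (j : ℕ) (hj : 1 ≤ j := by norm_num) : ε ^ j ≤ ε :=
    pow_le_of_le_one h0 (by linarith) (by omega)
  have hm : 1 - ε / 2 - ε ^ 2 / 8 - ε ^ 3 / 16 - 5 * ε ^ 4 / 64 ≤ √(1 - ε) := by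
    refine Real.le_sqrt_of_sq_le ?_
    have : 0 ≤ ε ^ 4 * (5 / 64 - 3 / 32 * ε - 3 / 128 * ε ^ 2 - 5 / 512 * ε ^ 3
        - 25 / 4096 * ε ^ 4) :=
      mul_nonneg (by positivity) (by linarith [hpow 2, hpow 3, hpow 4])
    linarith
  have hp : 1 + ε / 2 - ε ^ 2 / 8 + ε ^ 3 / 16 - 5 * ε ^ 4 / 64 ≤ √(1 + ε) := by
    refine Real.le_sqrt_of_sq_le ?_
    have : 0 ≤ ε ^ 4 * (5 / 64 + 3 / 32 * ε - 3 / 128 * ε ^ 2 + 5 / 512 * ε ^ 3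
        - 25 / 4096 * ε ^ 4) :=
      mul_nonneg (by positivity) (by linarith [hpow 2, hpow 4, pow_nonneg h0 3])
    linarith
  linarith

theorem le_inv_sqrt {t a : ℝ} (ht : 0 < t) (h : a ^ 2 * t ≤ 1) : a ≤ (√t)⁻¹ := by
  rw [← Real.sqrt_inv]
  refine Real.le_sqrt_of_sq_le ?_
  rwa [← one_div, le_div_iff₀ ht]

theorem inv_sqrt_le {t a : ℝ} (ht : 0 < t) (ha : 0 ≤ a) (h : 1 ≤ a ^ 2 * t) : (√t)⁻¹ ≤ a := by
  rw [← Real.sqrt_inv, Real.sqrt_le_left ha, inv_le_iff_one_le_mul₀ ht]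
  exact h

theorem le_inv_sqrt_add_inv_sqrt {ε : ℝ} (h0 : 0 ≤ ε) (h1 : ε ≤ 1 / 4) :
    3 / 4 * ε ^ 2 ≤ (√(1 - ε))⁻¹ + (√(1 + ε))⁻¹ - 2 := by
  have hm : 1 + ε / 2 + 3 / 8 * ε ^ 2 + 5 / 16 * ε ^ 3 ≤ (√(1 - ε))⁻¹ :=
    le_inv_sqrt (by linarith) (by
      have : 0 ≤ ε ^ 4 * (35 / 64 + 7 / 32 * ε + 35 / 256 * ε ^ 2 + 25 / 256 * ε ^ 3) := by
        positivity
      linarith)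
  have hp : 1 - ε / 2 + 3 / 8 * ε ^ 2 - 5 / 16 * ε ^ 3 ≤ (√(1 + ε))⁻¹ :=
    le_inv_sqrt (by linarith) (by
      have : 0 ≤ ε ^ 4 * (35 / 64 - 7 / 32 * ε + 35 / 256 * ε ^ 2 - 25 / 256 * ε ^ 3) :=
        mul_nonneg (by positivity)
          (by linarith [pow_nonneg h0 2, pow_le_of_le_one h0 (by linarith) three_ne_zero])
      linarith)
  linarith

/-- The Taylor coefficient of `ε⁴` on the left is `35/64`, slightly less than `16/25`. -/
theorem inv_sqrt_add_inv_sqrt_le {ε : ℝ} (h0 : 0 ≤ ε) (h1 : ε ≤ 11 / 50) :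
    (√(1 - ε))⁻¹ + (√(1 + ε))⁻¹ - 2 ≤ 3 / 4 * ε ^ 2 + 16 / 25 * ε ^ 4 := by
  have hm : (√(1 - ε))⁻¹ ≤ 1 + ε / 2 + 3 / 8 * ε ^ 2 + 5 / 16 * ε ^ 3 + 9 / 25 * ε ^ 4 :=
    inv_sqrt_le (by linarith) (by positivity) (by
      have h2 : ε ^ 2 ≤ 11 / 50 * ε := by nlinarith
      have : 0 ≤ ε ^ 4 * (277 / 1600 - 463 / 800 * ε - 1451 / 6400 * ε ^ 2
          - 913 / 6400 * ε ^ 3 - 477 / 5000 * ε ^ 4 - 81 / 625 * ε ^ 5) := by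
        refine mul_nonneg (by positivity) ?_
        have hpow (j : ℕ) (hj : 2 ≤ j := by norm_num) : ε ^ j ≤ ε ^ 2 :=
          pow_le_pow_of_le_one h0 (by linarith) hj
        linarith [hpow 3, hpow 4, hpow 5]
      linarith)
  have hp : (√(1 + ε))⁻¹ ≤ 1 - ε / 2 + 3 / 8 * ε ^ 2 - 5 / 16 * ε ^ 3 + 7 / 25 * ε ^ 4 :=
    inv_sqrt_le (by linarith)
      (by linarith [pow_nonneg h0 2, pow_nonneg h0 4,
        pow_le_of_le_one h0 (by linarith) three_ne_zero]) (by
      have : 0 ≤ ε ^ 4 * (21 / 1600 + 399 / 800 * ε - 1323 / 6400 * ε ^ 2 + 849 / 6400 * ε ^ 3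
          - 483 / 5000 * ε ^ 4 + 49 / 625 * ε ^ 5) := by
        refine mul_nonneg (by positivity) ?_
        have hpow (j : ℕ) (hj : 1 ≤ j := by norm_num) : ε ^ j ≤ ε :=
          pow_le_of_le_one h0 (by linarith) (by omega)
        linarith [hpow 2, hpow 4, pow_nonneg h0 3, pow_nonneg h0 5]
      linarith)
  linarith

/-! ### The bounds for large argument -/

/-- The regime of large argument: `w ≥ 43/10`, with `ε` of size `w⁻²`. -/
theorem large_argument_estimates {w ε : ℝ} (hw : 43 / 10 ≤ w) (h0 : 0 < ε)
    (he : ε * w ^ 2 ≤ 79 / 20) :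
    ε ≤ 11 / 50 ∧ ε ^ 2 ≤ 1 / 20 ∧ (19 / 5) ^ 2 ≤ w ^ 2 * (1 - ε) ∧ w * ε ^ 2 ≤ 1 / 5
      ∧ (ε * w ^ 2) ^ 2 ≤ 15.61 ∧ 79 ≤ w ^ 3 := by
  have hw2 : (43 / 10) ^ 2 ≤ w ^ 2 := by gcongr
  have hw3 : (43 / 10) ^ 3 ≤ w ^ 3 := by gcongr
  have hε : ε ≤ 107 / 500 := by nlinarith
  have hsq : (ε * w ^ 2) ^ 2 ≤ (79 / 20) ^ 2 := by gcongr
  refine ⟨by linarith, by nlinarith, by nlinarith, ?_, by linarith, by linarith⟩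
  have : (w * ε ^ 2) * w ^ 3 ≤ 1 / 5 * w ^ 3 := by
    calc (w * ε ^ 2) * w ^ 3 = (ε * w ^ 2) ^ 2 := by ring
      _ ≤ 1 / 5 * w ^ 3 := by linarith
  exact le_of_mul_le_mul_right this (by linarith)

theorem exp_neg_le_quadratic {x : ℝ} (h0 : 0 ≤ x) (h1 : x ≤ 1) :
    Real.exp (-x) ≤ 1 - x + x ^ 2 := by
  have h := Real.abs_exp_sub_one_sub_id_le (x := -x) (by rwa [abs_neg, abs_of_nonneg h0])
  have := (abs_le.1 h).2
  linarith

theorem turanRatio_lt_turanUpper {w ε : ℝ} (hw : 43 / 10 ≤ w) (h0 : 0 < ε)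
    (he : ε * w ^ 2 ≤ 79 / 20) : turanRatio w ε < turanUpper w ε := by
  obtain ⟨h1, h2, h3, h4, h5, h6⟩ := large_argument_estimates hw h0 he
  have hw0 : 0 < w := by linarith
  have hA := exp_neg_five_fourths_log_le (sq_nonneg ε) h2
  have hB : Real.exp (2 * w * (√(1 - ε) + √(1 + ε) - 2))
      ≤ 1 - w * ε ^ 2 / 2 + (w * ε ^ 2 / 2) ^ 2 := by
    refine le_trans (Real.exp_le_exp.2 ?_)
      (exp_neg_le_quadratic (by positivity) (by linarith))
    have := mul_le_mul_of_nonneg_left (sqrt_add_sqrt_le h0.le (by linarith)) hw0.le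
    linarith
  have hC : Real.exp (-(15 / (16 * w)) * ((√(1 - ε))⁻¹ + (√(1 + ε))⁻¹ - 2)
      - -3 / 16 * (ε ^ 2 / (w ^ 2 * (1 - ε ^ 2))))
      < 1 - 45 * ε ^ 2 / (64 * w) + 73 / (16 * w ^ 6) := by
    have hτ := mul_le_mul_of_nonneg_left (le_inv_sqrt_add_inv_sqrt h0.le (by linarith))
      (by positivity : 0 ≤ 15 / (16 * w))
    have hκ : ε ^ 2 / (w ^ 2 * (1 - ε ^ 2)) ≤ 16 / 15 * (ε ^ 2 / w ^ 2) := by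
      rw [← div_div, div_le_iff₀ (by linarith)]
      have : 0 ≤ ε ^ 2 / w ^ 2 := by positivity
      nlinarith
    have hx : 0 ≤ 45 * ε ^ 2 / (64 * w) - ε ^ 2 / (5 * w ^ 2) := by
      have e : 45 * ε ^ 2 / (64 * w) - ε ^ 2 / (5 * w ^ 2)
          = ε ^ 2 / w ^ 2 * (45 / 64 * w - 1 / 5) := by field_simp
      rw [e]
      exact mul_nonneg (by positivity) (by linarith)
    have hx1 : 45 * ε ^ 2 / (64 * w) - ε ^ 2 / (5 * w ^ 2) ≤ 45 * ε ^ 2 / (64 * w) := by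
      have : 0 ≤ ε ^ 2 / (5 * w ^ 2) := by positivity
      linarith
    have hx2 : 45 * ε ^ 2 / (64 * w) ≤ 1 := by
      rw [div_le_one (by positivity)]
      linarith
    calc _ ≤ Real.exp (-(45 * ε ^ 2 / (64 * w) - ε ^ 2 / (5 * w ^ 2))) := by
          refine Real.exp_le_exp.2 ?_
          have e : 15 / (16 * w) * (3 / 4 * ε ^ 2) = 45 * ε ^ 2 / (64 * w) := by
            field_simp
            norm_num
          have e' : ε ^ 2 / (5 * w ^ 2) = 1 / 5 * (ε ^ 2 / w ^ 2) := by field_simp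
          linarith
      _ ≤ 1 - (45 * ε ^ 2 / (64 * w) - ε ^ 2 / (5 * w ^ 2)) + (45 * ε ^ 2 / (64 * w)) ^ 2 :=
          (exp_neg_le_quadratic hx (hx1.trans hx2)).trans (by gcongr)
      _ < _ := by
        -- After multiplication by `w ^ 6` both error terms are bounded by constants.
        have e1 : ε ^ 2 / (5 * w ^ 2) = (ε * w ^ 2) ^ 2 / 5 / w ^ 6 := by field_simp
        have e2 : (45 * ε ^ 2 / (64 * w)) ^ 2
            = 45 ^ 2 / 64 ^ 2 * ((w * ε ^ 2) * (ε * w ^ 2) ^ 2 / w) / w ^ 6 := by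
          field_simp
        have e3 : 73 / (16 * w ^ 6) = 73 / 16 / w ^ 6 := by field_simp
        have hb : (w * ε ^ 2) * (ε * w ^ 2) ^ 2 / w ≤ 1 / 5 * 15.61 / 4 := by
          gcongr
          linarith
        rw [e1, e2, e3]
        have : (ε * w ^ 2) ^ 2 / 5 / w ^ 6
            + 45 ^ 2 / 64 ^ 2 * ((w * ε ^ 2) * (ε * w ^ 2) ^ 2 / w) / w ^ 6 < 73 / 16 / w ^ 6 := by
          rw [← add_div]
          gcongr
          linarith
        linarith
  refine (turanRatio_le_exp_logModel h0.le (by linarith) h3).trans_lt ?_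
  rw [logModel_second_difference (-3) hw0 h0.le (by linarith), Real.exp_add, Real.exp_add,
    turanUpper]
  have hA' : Real.exp (-(5 / 4) * Real.log (1 - ε ^ 2)) ≤ 1 + 5 / 4 * ε ^ 2 + 27 / 16 * ε ^ 4 := by
    linarith
  have hAB := mul_le_mul hA' hB (Real.exp_pos _).le (by positivity)
  exact mul_lt_mul' hAB hC (Real.exp_pos _).le (lt_of_lt_of_le (by positivity) hAB)

theorem turanLower_lt_turanRatio {w ε : ℝ} (hw : 43 / 10 ≤ w) (h0 : 0 < ε)
    (he : ε * w ^ 2 ≤ 79 / 20) : turanLower w ε < turanRatio w ε := by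
  obtain ⟨h1, h2, h3, h4, h5, h6⟩ := large_argument_estimates hw h0 he
  have hw0 : 0 < w := by linarith
  have hA := le_exp_neg_five_fourths_log (sq_nonneg ε) h2
  have hB : 1 - w * ε ^ 2 / 2 - 5 * w * ε ^ 4 / 16
      ≤ Real.exp (2 * w * (√(1 - ε) + √(1 + ε) - 2)) := by
    refine le_trans ?_ (Real.add_one_le_exp _)
    have := mul_le_mul_of_nonneg_left (le_sqrt_add_sqrt h0.le (by linarith)) hw0.le
    linarith
  have hB0 : 0 < 1 - w * ε ^ 2 / 2 - 5 * w * ε ^ 4 / 16 := by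
    have : (w * ε ^ 2) * ε ^ 2 ≤ 1 / 5 * (1 / 20) := by gcongr
    linarith
  have hC : 1 - 45 * ε ^ 2 / (64 * w) - 15 * ε ^ 2 / (32 * w ^ 2) - 75 / (16 * w ^ 6)
      < Real.exp (-(15 / (16 * w)) * ((√(1 - ε))⁻¹ + (√(1 + ε))⁻¹ - 2)
        - 9 / 16 * (ε ^ 2 / (w ^ 2 * (1 - ε ^ 2)))) := by
    have hτ := mul_le_mul_of_nonneg_left (inv_sqrt_add_inv_sqrt_le h0.le h1)
      (by positivity : 0 ≤ 15 / (16 * w))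
    have hκ : ε ^ 2 / (w ^ 2 * (1 - ε ^ 2)) ≤ 16 / 15 * (ε ^ 2 / w ^ 2) := by
      rw [← div_div, div_le_iff₀ (by linarith)]
      have : 0 ≤ ε ^ 2 / w ^ 2 := by positivity
      nlinarith
    refine lt_of_lt_of_le ?_ (Real.add_one_le_exp _)
    have e1 : 15 / (16 * w) * (3 / 4 * ε ^ 2 + 16 / 25 * ε ^ 4)
        = 45 * ε ^ 2 / (64 * w) + 3 / 5 * ((ε * w ^ 2) ^ 2 * (w * ε ^ 2) / w ^ 6) := by
      field_simp
      ring
    have e2 : ε ^ 2 / w ^ 2 = (ε * w ^ 2) ^ 2 / w ^ 6 := by field_simp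
    have e3 : 15 * ε ^ 2 / (32 * w ^ 2) = 15 / 32 * (ε ^ 2 / w ^ 2) := by field_simp
    have e4 : 75 / (16 * w ^ 6) = 75 / 16 / w ^ 6 := by field_simp
    rw [e2] at hκ e3
    rw [e1] at hτ
    rw [e3, e4]
    have hb : (ε * w ^ 2) ^ 2 * (w * ε ^ 2) ≤ 15.61 * (1 / 5) := by gcongr
    have : 3 / 5 * ((ε * w ^ 2) ^ 2 * (w * ε ^ 2)) / w ^ 6
        + (21 / 160 * (ε * w ^ 2) ^ 2) / w ^ 6 < 75 / 16 / w ^ 6 := by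
      rw [← add_div]
      gcongr
      linarith
    rw [mul_div_assoc, mul_div_assoc (21 / 160)] at this
    linarith
  refine lt_of_lt_of_le ?_ (exp_logModel_le_turanRatio h0.le (by linarith) h3)
  rw [logModel_second_difference 9 hw0 h0.le (by linarith), Real.exp_add, Real.exp_add,
    turanLower]
  have hA' : 1 + 5 / 4 * ε ^ 2 + 45 / 32 * ε ^ 4 ≤ Real.exp (-(5 / 4) * Real.log (1 - ε ^ 2)) := by
    linarith
  have hAB := mul_le_mul hA' hB hB0.le (Real.exp_pos _).le
  calc _ < (1 + 5 / 4 * ε ^ 2 + 45 / 32 * ε ^ 4) * (1 - w * ε ^ 2 / 2 - 5 * w * ε ^ 4 / 16)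
        * Real.exp _ := mul_lt_mul_of_pos_left hC (by positivity)
    _ ≤ _ := mul_le_mul_of_nonneg_right hAB (Real.exp_pos _).le

/-! ### The bounds for small argument -/

/-- The partial sum of `G_2` with `M` terms. -/
noncomputable def besselPartial (M : ℕ) (s : ℝ) : ℝ :=
  ∑ m ∈ Finset.range M, s ^ m / ((m.factorial : ℝ) * ((m + 2).factorial : ℝ))

/-- The partial sum of `G_2` with `M` terms, plus a majorant of the tail. -/
noncomputable def besselPartialUpper (M : ℕ) (s : ℝ) : ℝ :=
  besselPartial M s + 2 * (s ^ M / ((M.factorial : ℝ) * ((M + 2).factorial : ℝ)))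

theorem turanRatio_le_of_mem_Icc (M : ℕ) {w w₁ w₂ ε : ℝ} (h0 : 0 ≤ ε) (h1 : ε ≤ 1) (hw₁ : 0 < w₁)
    (h₁ : w₁ ≤ w) (h₂ : w ≤ w₂) (hM : 2 * (w₂ ^ 2 * (1 + ε)) ≤ (M + 1) * (M + 3))
    (hP : 0 < besselPartial M (w₁ ^ 2)) :
    turanRatio w ε ≤ besselPartialUpper M (w₂ ^ 2 * (1 - ε))
      * besselPartialUpper M (w₂ ^ 2 * (1 + ε)) / besselPartial M (w₁ ^ 2) ^ 2 := by
  have hw : 0 < w := hw₁.trans_le h₁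
  have hm : 0 ≤ 1 - ε := by linarith
  have h (c : ℝ) (hc : 0 ≤ c) (hc' : c ≤ 1 + ε) :
      besselG 2 (w ^ 2 * c) ≤ besselPartialUpper M (w₂ ^ 2 * c) := by
    refine (besselG_mono 2 (by positivity) (by gcongr : w ^ 2 * c ≤ w₂ ^ 2 * c)).trans ?_
    refine besselG_le_sum_add 2 M (by positivity) ?_
    have : w₂ ^ 2 * c ≤ w₂ ^ 2 * (1 + ε) := by gcongr
    push_cast
    linarith
  have hlow : besselPartial M (w₁ ^ 2) ≤ besselG 2 (w ^ 2) :=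
    (sum_le_besselG 2 M (sq_nonneg w₁)).trans (besselG_mono 2 (sq_nonneg _) (by gcongr))
  have hm' := h _ hm (by linarith)
  have hp' := h (1 + ε) (by linarith) le_rfl
  have := (besselG_pos 2 (mul_nonneg (sq_nonneg w) hm)).le
  have := (besselG_pos 2 (mul_nonneg (sq_nonneg w) (by linarith : 0 ≤ 1 + ε))).le
  have := this.trans hp'
  have := (besselG_pos 2 (mul_nonneg (sq_nonneg w) hm)).le.trans hm'
  rw [turanRatio]
  gcongr

theorem le_turanRatio_of_mem_Icc (M : ℕ) {w w₁ w₂ ε : ℝ} (h0 : 0 ≤ ε) (h1 : ε ≤ 1) (hw₁ : 0 < w₁)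
    (h₁ : w₁ ≤ w) (h₂ : w ≤ w₂) (hM : 2 * (w₂ ^ 2 * (1 + ε)) ≤ (M + 1) * (M + 3)) :
    besselPartial M (w₁ ^ 2 * (1 - ε)) * besselPartial M (w₁ ^ 2 * (1 + ε))
      / besselPartialUpper M (w₂ ^ 2) ^ 2 ≤ turanRatio w ε := by
  have hw : 0 < w := hw₁.trans_le h₁
  have hm : 0 ≤ 1 - ε := by linarith
  have h (c : ℝ) (hc : 0 ≤ c) :
      besselPartial M (w₁ ^ 2 * c) ≤ besselG 2 (w ^ 2 * c) :=
    (sum_le_besselG 2 M (by positivity)).trans (besselG_mono 2 (by positivity) (by gcongr))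
  have hup : besselG 2 (w ^ 2) ≤ besselPartialUpper M (w₂ ^ 2) := by
    refine (besselG_mono 2 (sq_nonneg _) (by gcongr : w ^ 2 ≤ w₂ ^ 2)).trans ?_
    refine besselG_le_sum_add 2 M (sq_nonneg _) ?_
    have : 0 ≤ w₂ ^ 2 * ε := by positivity
    push_cast
    linarith
  have h0' (s : ℝ) (hs : 0 ≤ s) : 0 ≤ besselPartial M s :=
    Finset.sum_nonneg fun m _ => by positivity
  have hm' := h _ hm
  have hp' := h (1 + ε) (by linarith)
  have := besselG_pos 2 (sq_nonneg w)
  have := (besselG_pos 2 (mul_nonneg (sq_nonneg w) hm)).le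
  have := (besselG_pos 2 (mul_nonneg (sq_nonneg w) (by linarith : 0 ≤ 1 + ε))).le
  have := h0' (w₁ ^ 2 * (1 + ε)) (by positivity)
  rw [turanRatio]
  gcongr

theorem le_turanUpper_of_mem_Icc {w w₁ w₂ ε : ℝ} (hw₁ : 0 < w₁) (h₁ : w₁ ≤ w)
    (h₂ : w ≤ w₂) (hB : w₂ * ε ^ 2 ≤ 2) (hC : 45 * ε ^ 2 ≤ 64 * w₁) :
    (1 + 5 / 4 * ε ^ 2 + 27 / 16 * ε ^ 4) * (1 - w₂ * ε ^ 2 / 2 + (w₁ * ε ^ 2 / 2) ^ 2)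
      * (1 - 45 * ε ^ 2 / (64 * w₁) + 73 / (16 * w₂ ^ 6)) ≤ turanUpper w ε := by
  have hw : 0 < w := hw₁.trans_le h₁
  have hw₂ : 0 < w₂ := hw.trans_le h₂
  have hB' : 0 ≤ 1 - w₂ * ε ^ 2 / 2 + (w₁ * ε ^ 2 / 2) ^ 2 := by
    have : 0 ≤ (w₁ * ε ^ 2 / 2) ^ 2 := sq_nonneg _
    linarith
  have hC' : 0 ≤ 1 - 45 * ε ^ 2 / (64 * w₁) + 73 / (16 * w₂ ^ 6) := by
    have h : 45 * ε ^ 2 / (64 * w₁) ≤ 1 := (div_le_one (by positivity)).2 hC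
    have : 0 ≤ 73 / (16 * w₂ ^ 6) := by positivity
    linarith
  have hBB : 1 - w₂ * ε ^ 2 / 2 + (w₁ * ε ^ 2 / 2) ^ 2
      ≤ 1 - w * ε ^ 2 / 2 + (w * ε ^ 2 / 2) ^ 2 := by gcongr
  have hCC : 1 - 45 * ε ^ 2 / (64 * w₁) + 73 / (16 * w₂ ^ 6)
      ≤ 1 - 45 * ε ^ 2 / (64 * w) + 73 / (16 * w ^ 6) := by gcongr
  rw [turanUpper]
  exact mul_le_mul (mul_le_mul_of_nonneg_left hBB (by positivity)) hCC hC'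
    (mul_nonneg (by positivity) (hB'.trans hBB))

theorem turanLower_le_of_mem_Icc {w w₁ w₂ ε : ℝ} (hw₁ : 0 < w₁) (h₁ : w₁ ≤ w)
    (h₂ : w ≤ w₂) (hB : w₁ * ε ^ 2 / 2 + 5 * w₁ * ε ^ 4 / 16 ≤ 1)
    (hC : 45 * ε ^ 2 / (64 * w₁) + 15 * ε ^ 2 / (32 * w₁ ^ 2) + 75 / (16 * w₁ ^ 6) ≤ 1) :
    turanLower w ε ≤
      (1 + 5 / 4 * ε ^ 2 + 45 / 32 * ε ^ 4) * (1 - w₁ * ε ^ 2 / 2 - 5 * w₁ * ε ^ 4 / 16)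
      * (1 - 45 * ε ^ 2 / (64 * w₂) - 15 * ε ^ 2 / (32 * w₂ ^ 2) - 75 / (16 * w₂ ^ 6)) := by
  have hw : 0 < w := hw₁.trans_le h₁
  have hw₂ : 0 < w₂ := hw.trans_le h₂
  have hBB : 1 - w * ε ^ 2 / 2 - 5 * w * ε ^ 4 / 16
      ≤ 1 - w₁ * ε ^ 2 / 2 - 5 * w₁ * ε ^ 4 / 16 := by gcongr
  have hCC : 1 - 45 * ε ^ 2 / (64 * w) - 15 * ε ^ 2 / (32 * w ^ 2) - 75 / (16 * w ^ 6)
      ≤ 1 - 45 * ε ^ 2 / (64 * w₂) - 15 * ε ^ 2 / (32 * w₂ ^ 2) - 75 / (16 * w₂ ^ 6) := by gcongr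
  have hC' : 0 ≤ 1 - 45 * ε ^ 2 / (64 * w) - 15 * ε ^ 2 / (32 * w ^ 2) - 75 / (16 * w ^ 6) := by
    have : 1 - 45 * ε ^ 2 / (64 * w₁) - 15 * ε ^ 2 / (32 * w₁ ^ 2) - 75 / (16 * w₁ ^ 6)
      ≤ 1 - 45 * ε ^ 2 / (64 * w) - 15 * ε ^ 2 / (32 * w ^ 2) - 75 / (16 * w ^ 6) := by gcongr
    linarith
  rw [turanLower]
  exact mul_le_mul (mul_le_mul_of_nonneg_left hBB (by positivity)) hCC hC'
    (mul_nonneg (by positivity) (by linarith))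

theorem mem_Icc_of_sq_eq {w w₁ w₂ c : ℝ} (hw : 0 ≤ w) (hc : 0 ≤ c) (h : w ^ 2 = c * Real.pi ^ 2)
    (h₁ : w₁ ^ 2 ≤ c * 3.141592 ^ 2) (h₂ : c * 3.141593 ^ 2 ≤ w₂ ^ 2) (hw₂ : 0 ≤ w₂) :
    w₁ ≤ w ∧ w ≤ w₂ := by
  have hp1 := Real.pi_gt_d6.le
  have hp2 := Real.pi_lt_d6.le
  constructor
  · refine le_of_sq_le_sq (h₁.trans ?_) hw
    rw [h]
    gcongr
  · refine le_of_sq_le_sq (le_trans ?_ h₂) hw₂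
    rw [h]
    gcongr

/-- Both bounds at a point `w` with `w² = c π²`, reduced to inequalities between explicit numbers:
`w₁ ≤ w ≤ w₂` encloses the point, and `M` terms of the series are summed. -/
theorem turan_bounds_of_enclosure {w ε c : ℝ} (M : ℕ) (w₁ w₂ : ℝ) (hw : 0 ≤ w)
    (h : w ^ 2 = c * Real.pi ^ 2) (h0 : 0 ≤ ε) (h1 : ε ≤ 1) (hc : 0 ≤ c) (hw₁ : 0 < w₁)
    (hw₂ : 0 ≤ w₂) (hc₁ : w₁ ^ 2 ≤ c * 3.141592 ^ 2) (hc₂ : c * 3.141593 ^ 2 ≤ w₂ ^ 2)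
    (hM : 2 * (w₂ ^ 2 * (1 + ε)) ≤ (M + 1) * (M + 3)) (hP : 0 < besselPartial M (w₁ ^ 2))
    (hB : w₂ * ε ^ 2 ≤ 2) (hC : 45 * ε ^ 2 ≤ 64 * w₁)
    (hB' : w₁ * ε ^ 2 / 2 + 5 * w₁ * ε ^ 4 / 16 ≤ 1)
    (hC' : 45 * ε ^ 2 / (64 * w₁) + 15 * ε ^ 2 / (32 * w₁ ^ 2) + 75 / (16 * w₁ ^ 6) ≤ 1)
    (hU : besselPartialUpper M (w₂ ^ 2 * (1 - ε)) * besselPartialUpper M (w₂ ^ 2 * (1 + ε))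
        / besselPartial M (w₁ ^ 2) ^ 2
      < (1 + 5 / 4 * ε ^ 2 + 27 / 16 * ε ^ 4) * (1 - w₂ * ε ^ 2 / 2 + (w₁ * ε ^ 2 / 2) ^ 2)
        * (1 - 45 * ε ^ 2 / (64 * w₁) + 73 / (16 * w₂ ^ 6)))
    (hL : (1 + 5 / 4 * ε ^ 2 + 45 / 32 * ε ^ 4) * (1 - w₁ * ε ^ 2 / 2 - 5 * w₁ * ε ^ 4 / 16)
        * (1 - 45 * ε ^ 2 / (64 * w₂) - 15 * ε ^ 2 / (32 * w₂ ^ 2) - 75 / (16 * w₂ ^ 6))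
      < besselPartial M (w₁ ^ 2 * (1 - ε)) * besselPartial M (w₁ ^ 2 * (1 + ε))
        / besselPartialUpper M (w₂ ^ 2) ^ 2) :
    turanRatio w ε < turanUpper w ε ∧ turanLower w ε < turanRatio w ε := by
  obtain ⟨h₁, h₂⟩ := mem_Icc_of_sq_eq hw hc h hc₁ hc₂ hw₂
  exact ⟨(turanRatio_le_of_mem_Icc M h0 h1 hw₁ h₁ h₂ hM hP).trans_lt
      (hU.trans_le (le_turanUpper_of_mem_Icc hw₁ h₁ h₂ hB hC)),
    (turanLower_le_of_mem_Icc hw₁ h₁ h₂ hB' hC').trans_lt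
      (hL.trans_le (le_turanRatio_of_mem_Icc M h0 h1 hw₁ h₁ h₂ hM))⟩

/-! ### Return to the arguments `k` and `n` -/

theorem alphak_pos (k : ℕ) : 0 < alphak k := by
  rw [alphak]
  positivity

theorem sq_xk {k : ℕ} {n : ℝ} (h : 0 ≤ 24 * n - (2 * (k : ℝ) + 2)) :
    xk k n ^ 2 = Real.pi ^ 2 * (24 * n - (2 * (k : ℝ) + 2)) / 36 := by
  rw [xk, div_pow, mul_pow, Real.sq_sqrt h]
  norm_num

theorem Mk_eq {k : ℕ} {n : ℝ} (h : xk k n ≠ 0) :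
    Mk k n = alphak k ^ 2 * Real.pi ^ 3 / 72 * besselG 2 (alphak k * xk k n ^ 2 / 4) := by
  have hα : √(alphak k) ^ 2 = alphak k := Real.sq_sqrt (alphak_pos k).le
  rw [Mk, besselI_eq_besselG, div_pow, mul_pow, hα]
  field_simp
  ring_nf

/-- `Λ_k(n)` is the quotient `turanRatio` at `w = √α_k x_k(n) / 2`, because `x_k(n ± 1)²` is
`x_k(n)² (1 ± ε)`. -/
theorem Lambdak_eq_turanRatio {k : ℕ} {n : ℝ} (h : 0 < 24 * (n - 1) - (2 * (k : ℝ) + 2)) :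
    Lambdak k n
      = turanRatio (√(alphak k) * xk k n / 2) (24 / (24 * n - (2 * (k : ℝ) + 2))) := by
  have hN : 0 < 24 * n - (2 * (k : ℝ) + 2) := by linarith
  have hN' : 0 < 24 * (n + 1) - (2 * (k : ℝ) + 2) := by linarith
  have hx {m : ℝ} (hm : 0 < 24 * m - (2 * (k : ℝ) + 2)) : xk k m ≠ 0 :=
    (div_pos (mul_pos Real.pi_pos (Real.sqrt_pos.2 hm)) (by norm_num)).ne'
  have hα : √(alphak k) ^ 2 = alphak k := Real.sq_sqrt (alphak_pos k).le
  have hG := besselG_pos 2 (s := alphak k * xk k n ^ 2 / 4)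
    (by have := alphak_pos k; positivity)
  have hw : (√(alphak k) * xk k n / 2) ^ 2 = alphak k * xk k n ^ 2 / 4 := by
    rw [div_pow, mul_pow, hα]
    norm_num
  have hm : alphak k * xk k (n - 1) ^ 2 / 4
      = alphak k * xk k n ^ 2 / 4 * (1 - 24 / (24 * n - (2 * (k : ℝ) + 2))) := by
    rw [sq_xk h.le, sq_xk hN.le,
      show 24 * (n - 1) - (2 * (k : ℝ) + 2) = 24 * n - (2 * (k : ℝ) + 2) - 24 by ring]
    generalize 24 * n - (2 * (k : ℝ) + 2) = N at hN
    field_simp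
  have hp : alphak k * xk k (n + 1) ^ 2 / 4
      = alphak k * xk k n ^ 2 / 4 * (1 + 24 / (24 * n - (2 * (k : ℝ) + 2))) := by
    rw [sq_xk hN'.le, sq_xk hN.le,
      show 24 * (n + 1) - (2 * (k : ℝ) + 2) = 24 * n - (2 * (k : ℝ) + 2) + 24 by ring]
    generalize 24 * n - (2 * (k : ℝ) + 2) = N at hN
    field_simp
  have hα0 := (alphak_pos k).ne'
  rw [Lambdak, Mk_eq (hx h), Mk_eq (hx hN), Mk_eq (hx hN'), turanRatio, hw, ← hm, ← hp]
  field_simp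

/-- The two bounds in the variables `w` and `ε`. The estimates for large argument cover `n ≥ 5`;
the remaining six cases are numerical. -/
theorem turan_bounds (k : ℕ) (hk : k = 1 ∨ k = 2) (n : ℕ) (hn : 2 ≤ n) {w ε : ℝ} (hw : 0 ≤ w)
    (h : w ^ 2 = alphak k * (24 * n - (2 * (k : ℝ) + 2)) / 144 * Real.pi ^ 2)
    (hε : ε = 24 / (24 * n - (2 * (k : ℝ) + 2))) :
    turanRatio w ε < turanUpper w ε ∧ turanLower w ε < turanRatio w ε := by
  rcases lt_or_ge n 5 with h5 | h5
  · -- The decimals enclose `w = (π / 12) √(α_k (24 n - 2 k - 2))`.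
    subst hε
    rcases hk with rfl | rfl <;> interval_cases n
    · refine turan_bounds_of_enclosure 10 2.6526 2.6527 hw h ?_ ?_ ?_ ?_ ?_ ?_ ?_ ?_ ?_ ?_ ?_ ?_ ?_
        ?_ ?_ <;> norm_num [alphak, besselPartial, besselPartialUpper, Finset.sum_range_succ,
          Nat.factorial]
    · refine turan_bounds_of_enclosure 10 3.2977 3.2978 hw h ?_ ?_ ?_ ?_ ?_ ?_ ?_ ?_ ?_ ?_ ?_ ?_ ?_
        ?_ ?_ <;> norm_num [alphak, besselPartial, besselPartialUpper, Finset.sum_range_succ,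
          Nat.factorial]
    · refine turan_bounds_of_enclosure 10 3.8357 3.8358 hw h ?_ ?_ ?_ ?_ ?_ ?_ ?_ ?_ ?_ ?_ ?_ ?_ ?_
        ?_ ?_ <;> norm_num [alphak, besselPartial, besselPartialUpper, Finset.sum_range_succ,
          Nat.factorial]
    · refine turan_bounds_of_enclosure 10 2.6284 2.6285 hw h ?_ ?_ ?_ ?_ ?_ ?_ ?_ ?_ ?_ ?_ ?_ ?_ ?_
        ?_ ?_ <;> norm_num [alphak, besselPartial, besselPartialUpper, Finset.sum_range_succ,
          Nat.factorial]
    · refine turan_bounds_of_enclosure 10 3.2949 3.2950 hw h ?_ ?_ ?_ ?_ ?_ ?_ ?_ ?_ ?_ ?_ ?_ ?_ ?_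
        ?_ ?_ <;> norm_num [alphak, besselPartial, besselPartialUpper, Finset.sum_range_succ,
          Nat.factorial]
    · refine turan_bounds_of_enclosure 10 3.8476 3.8477 hw h ?_ ?_ ?_ ?_ ?_ ?_ ?_ ?_ ?_ ?_ ?_ ?_ ?_
        ?_ ?_ <;> norm_num [alphak, besselPartial, besselPartialUpper, Finset.sum_range_succ,
          Nat.factorial]
  · have hn5 : (5 : ℝ) ≤ n := by exact_mod_cast h5
    have hk2 : (k : ℝ) ≤ 2 := by rcases hk with rfl | rfl <;> norm_num
    have hN : 0 < 24 * (n : ℝ) - (2 * (k : ℝ) + 2) := by linarith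
    have hπ1 : (3.141592 : ℝ) ^ 2 ≤ Real.pi ^ 2 := by gcongr; exact Real.pi_gt_d6.le
    have hπ2 : Real.pi ^ 2 ≤ (3.141593 : ℝ) ^ 2 := by gcongr; exact Real.pi_lt_d6.le
    have hε0 : 0 < ε := by rw [hε]; positivity
    have he : ε * w ^ 2 = alphak k / 6 * Real.pi ^ 2 := by
      rw [h, hε]
      generalize 24 * (n : ℝ) - (2 * (k : ℝ) + 2) = N at hN
      field_simp
      ring
    have he' : ε * w ^ 2 ≤ 79 / 20 := by
      have : alphak k ≤ 12 / 5 := by rcases hk with rfl | rfl <;> norm_num [alphak]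
      rw [he]
      nlinarith [sq_nonneg Real.pi]
    have hc : 270 ≤ alphak k * (24 * n - (2 * (k : ℝ) + 2)) := by
      rcases hk with rfl | rfl <;> norm_num [alphak] <;> linarith
    have hw' : 43 / 10 ≤ w := by
      refine le_of_sq_le_sq ?_ hw
      rw [h]
      nlinarith
    exact ⟨turanRatio_lt_turanUpper hw' hε0 he', turanLower_lt_turanRatio hw' hε0 he'⟩

end BrokenDiamond

theorem mainTheorem4 (k : ℕ) (hk : k = 1 ∨ k = 2) (n : ℕ) (hn : 2 ≤ n) :
    BrokenDiamond.Lambdak k n <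
        (1 + 5 * Real.pi ^ 4 / (9 * BrokenDiamond.xk k n ^ 4)
            + Real.pi ^ 8 / (3 * BrokenDiamond.xk k n ^ 8))
          * (1 - Real.sqrt (BrokenDiamond.alphak k) * Real.pi ^ 4
                / (9 * BrokenDiamond.xk k n ^ 3)
            + BrokenDiamond.alphak k * Real.pi ^ 8 / (81 * BrokenDiamond.xk k n ^ 6))
          * (1 - 5 * Real.pi ^ 4
                / (8 * Real.sqrt (BrokenDiamond.alphak k) * BrokenDiamond.xk k n ^ 5)
            + 292 / (BrokenDiamond.alphak k ^ 3 * BrokenDiamond.xk k n ^ 6)) ∧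
      (1 + 5 * Real.pi ^ 4 / (9 * BrokenDiamond.xk k n ^ 4)
            + 5 * Real.pi ^ 8 / (18 * BrokenDiamond.xk k n ^ 8))
          * (1 - Real.sqrt (BrokenDiamond.alphak k) * Real.pi ^ 4
                / (9 * BrokenDiamond.xk k n ^ 3)
            - 5 * Real.sqrt (BrokenDiamond.alphak k) * Real.pi ^ 8
                / (162 * BrokenDiamond.xk k n ^ 7))
          * (1 - 5 * Real.pi ^ 4
                / (8 * Real.sqrt (BrokenDiamond.alphak k) * BrokenDiamond.xk k n ^ 5)
            - 5 * Real.pi ^ 4 / (6 * BrokenDiamond.alphak k * BrokenDiamond.xk k n ^ 6)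
            - 300 / (BrokenDiamond.alphak k ^ 3 * BrokenDiamond.xk k n ^ 6)) <
        BrokenDiamond.Lambdak k n := by
  have hkr : 0 ≤ (k : ℝ) ∧ (k : ℝ) ≤ 2 := by rcases hk with rfl | rfl <;> norm_num
  have hn2 : (2 : ℝ) ≤ n := by exact_mod_cast hn
  have h : 0 < 24 * ((n : ℝ) - 1) - (2 * (k : ℝ) + 2) := by linarith
  have hN : 0 < 24 * (n : ℝ) - (2 * (k : ℝ) + 2) := by linarith
  have hx : 0 < BrokenDiamond.xk k n :=
    div_pos (mul_pos Real.pi_pos (Real.sqrt_pos.2 hN)) (by norm_num)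
  have hx2 := BrokenDiamond.sq_xk hN.le
  have hα := BrokenDiamond.alphak_pos k
  have ha : 0 < √(BrokenDiamond.alphak k) := Real.sqrt_pos.2 hα
  have ha2 : BrokenDiamond.alphak k = √(BrokenDiamond.alphak k) ^ 2 := (Real.sq_sqrt hα.le).symm
  have hε : 24 / (24 * (n : ℝ) - (2 * (k : ℝ) + 2))
      = 2 * Real.pi ^ 2 / (3 * BrokenDiamond.xk k n ^ 2) := by
    rw [hx2]
    field_simp
    norm_num
  have hΛ := BrokenDiamond.Lambdak_eq_turanRatio h
  have key := BrokenDiamond.turan_bounds k hk n hn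
    (w := √(BrokenDiamond.alphak k) * BrokenDiamond.xk k n / 2) (by positivity)
    (by rw [div_pow, mul_pow, ← ha2, hx2]; ring) rfl
  rw [← hΛ, hε] at key
  -- With `α = a²`, `w = a x / 2` and `ε = 2 π² / (3 x²)` both sides agree factor by factor.
  generalize √(BrokenDiamond.alphak k) = a at *
  generalize BrokenDiamond.xk k n = x at *
  rw [ha2]
  refine ⟨key.1.trans_eq ?_, key.2.trans_eq' ?_⟩
  · rw [BrokenDiamond.turanUpper]
    refine congrArg₂ _ (congrArg₂ _ ?_ ?_) ?_ <;> field_simp <;> ring_nf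
  · rw [BrokenDiamond.turanLower]
    refine congrArg₂ _ (congrArg₂ _ ?_ ?_) ?_ <;> field_simp <;> ring_nf
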